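/- Let $\|\cdot\|_q$ denote the $\ell^q$ norm and let $q\in(1,\infty]$. Let $(U_v)_{v\in\mathbb Z^2}$ be independent random variables, uniform on $(0,1)$, and for $\theta\in[0,1]$ give each vertex $v\in\mathbb Z^2$ the Rough Mount Fuji (RMF) label $$X_v=U_v+\theta\,\|v\|_q .$$ A non-backtracking path is an infinite simple nearest-neighbour path $0=x_0,x_1,x_2,\ldots$ in $\mathbb Z^2$ each of whose steps moves further from the origin in graph distance, i.e. $\|x_{j+1}\|_1>\|x_j\|_1$ for all $j\ge 0$ (for $q<\infty$ this is the same as $\|x_{j+1}\|_q>\|x_j\|_q$ for all $j\ge 0$). RMF accessibility percolation with non-backtracking paths and the $\ell^q$ distance is said to occur if there is a non-backtracking path with $X_{x_0}<X_{x_1}<X_{x_2}<\cdots$. Write $\mathbb P_\theta$ for the corresponding probability and $$\theta_c=\inf\{\theta\in[0,1]:\mathbb P_\theta(\text{RMF accessibility percolation})>0\}.$$ **Proposition.** For every $q\in(1,\infty]$ there is $\theta_0\in[0,1)$, depending only on $q$, such that for all $\theta\in(\theta_0,1)$, RMF accessibility percolation on $\mathbb Z^2$ with non-backtracking paths and the $\ell^q$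 distance occurs with positive probability. In particular $\theta_c<1$. -/

import Mathlib

open MeasureTheory
open scoped ENNReal

namespace RMF

/-- The graph distance `‖x - y‖₁` on the integer lattice `ℤⁿ`. -/
def graphDist {n : ℕ} (x y : Fin n → ℤ) : ℤ := ∑ i, |x i - y i|

/-- Nearest-neighbour adjacency in the lattice `ℤⁿ`. -/
def Adj {n : ℕ} (x y : Fin n → ℤ) : Prop := graphDist x y = 1

/-- The `ℓ^q` distance `‖x - y‖_q` on `ℤⁿ`, for `q ∈ [1, ∞]` (`q = ⊤` is the sup distance). -/
noncomputable def lqDist {n : ℕ} (q : ℝ≥0∞) (x y : Fin n → ℤ) : ℝ :=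
  ‖WithLp.toLp q (fun i => ((x i : ℝ) - (y i : ℝ)))‖

/-- The uniform distribution on the interval `(0, 1)`. -/
noncomputable def uniform01 : Measure ℝ := volume.restrict (Set.Ioo (0 : ℝ) 1)

instance : IsProbabilityMeasure uniform01 :=
  ⟨by simp [uniform01]⟩

/-- The joint law of a family `(U_v)`, `v ∈ ℤⁿ`, of independent uniform random variables
on `(0, 1)`. -/
noncomputable def uniformField (n : ℕ) : Measure ((Fin n → ℤ) → ℝ) :=
  Measure.infinitePi (fun _ : Fin n → ℤ => uniform01)

/-- The Rough Mount Fuji label `X_v = U_v + θ d(0, v)`, where `d` is the `ℓ^q` distance. -/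
noncomputable def label {n : ℕ} (q : ℝ≥0∞) (θ : ℝ) (U : (Fin n → ℤ) → ℝ) (v : Fin n → ℤ) : ℝ :=
  U v + θ * lqDist q 0 v

/-- Infinite non-backtracking paths in `ℤⁿ` from the origin: simple nearest-neighbour paths each
of whose steps moves further from the origin.

Distance from the origin is graph distance here. Along an edge exactly one `|x i|` changes (by one),
so for every `q < ∞` this is the same as a strict increase of the `ℓ^q` distance. For `q = ∞` a
strict increase of the sup distance would only leave the straight paths along the axes (a path at
`k e₁` could only go to `(k + 1) e₁`), whereas the non-backtracking paths in the
positive quadrant are to be all the paths whose coordinates do not decrease. -/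
structure IsNonBacktrackingPath {n : ℕ} (x : ℕ → Fin n → ℤ) : Prop where
  start : x 0 = 0
  adj : ∀ j, Adj (x j) (x (j + 1))
  simple : Function.Injective x
  away : ∀ j, graphDist 0 (x j) < graphDist 0 (x (j + 1))

/-- The event that accessibility percolation occurs along non-backtracking paths: the labels
increase along some infinite non-backtracking path from the origin. -/
def percolationEvent (n : ℕ) (q : ℝ≥0∞) (θ : ℝ) : Set ((Fin n → ℤ) → ℝ) :=
  {U | ∃ x : ℕ → Fin n → ℤ, IsNonBacktrackingPath x ∧
    ∀ j, label q θ U (x j) < label q θ U (x (j + 1))}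

/-- The critical parameter
`θ_c = inf {θ ∈ [0, 1] : P_θ(accessibility percolation) > 0}` for non-backtracking paths. -/
noncomputable def thetaC (n : ℕ) (q : ℝ≥0∞) : ℝ :=
  sInf {θ : ℝ | θ ∈ Set.Icc (0 : ℝ) 1 ∧ 0 < uniformField n (percolationEvent n q θ)}

end RMF

/-! In the cone `N * b ≤ a` about the first axis a step to the right raises the `ℓ^q` norm by at
least `1 - δ`, where `N * δ` is as small as desired for large `N` because `q > 1`
(`eventually_one_sub_le_lqDist_increment`). With `η = 1 - θ * (1 - δ)`, such a step is legal as soon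
as both of its sites have `U` in `(η, 1)`. A step up is legal as soon as `U` increases along it.

The cone is renormalised into blocks of `N` columns and two rows. An open block has all its values
of `U` in `(η, 1)` and a column in which `U` passes from below `1/2` to at least `1/2`, so it can be
crossed in its lower row or with a change of row. It is closed with probability at most `2 * N * η +
(3 / 4) ^ N`, which is small if `N` is large and then `θ` is close to `1`.

A path of open blocks that stays level or rises by one, below the diagonal, yields an increasing
path (`mem_percolationEvent_of_notMem`). By duality it exists unless a simple dual path, stepping up
only from closed blocks, ends above the diagonal (`exists_open_lipschitz_path`). A Peierls count
bounds the probability of that obstruction by `1/3` (`uniformField_blockedEvent_le`). -/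

namespace RMF

/-! ### Growth of the `ℓ^q` norm near the first axis -/

/-- The lattice site with coordinates `a` and `b`. -/
def site (a b : ℤ) : Fin 2 → ℤ := ![a, b]

lemma lqDist_zero_site_of_ne_top {q : ℝ≥0∞} (hq : 1 < q) (hq' : q ≠ ∞) {a b : ℤ}
    (ha : 0 ≤ a) (hb : 0 ≤ b) :
    lqDist q 0 (site a b) = ((a : ℝ) ^ q.toReal + (b : ℝ) ^ q.toReal) ^ (1 / q.toReal) := by
  have h0 : 0 < q.toReal := ENNReal.toReal_pos (by positivity) hq'
  have ha' : (0 : ℝ) ≤ a := by exact_mod_cast ha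
  have hb' : (0 : ℝ) ≤ b := by exact_mod_cast hb
  rw [lqDist, PiLp.norm_eq_sum h0]
  simp [site, abs_of_nonneg ha', abs_of_nonneg hb']

lemma lqDist_top_zero_site {a b : ℤ} (ha : 0 ≤ a) (hb : 0 ≤ b) :
    lqDist ∞ 0 (site a b) = max (a : ℝ) b := by
  have ha' : (0 : ℝ) ≤ a := by exact_mod_cast ha
  have hb' : (0 : ℝ) ≤ b := by exact_mod_cast hb
  rw [lqDist, PiLp.norm_toLp, Pi.norm_def]
  simp [site, Fin.univ_succ, Real.norm_eq_abs, abs_of_nonneg ha', abs_of_nonneg hb']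

lemma lqDist_le_lqDist_up {q : ℝ≥0∞} (hq : 1 < q) {a b : ℤ} (ha : 0 ≤ a) (hb : 0 ≤ b) :
    lqDist q 0 (site a b) ≤ lqDist q 0 (site a (b + 1)) := by
  have ha' : (0 : ℝ) ≤ a := by exact_mod_cast ha
  have hb' : (0 : ℝ) ≤ b := by exact_mod_cast hb
  by_cases hq' : q = ∞
  · subst hq'
    rw [lqDist_top_zero_site ha hb, lqDist_top_zero_site ha (by omega)]
    push_cast
    gcongr
    linarith
  · have h0 : 0 < q.toReal := ENNReal.toReal_pos (by positivity) hq'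
    rw [lqDist_zero_site_of_ne_top hq hq' ha hb,
      lqDist_zero_site_of_ne_top hq hq' ha (by omega)]
    push_cast
    gcongr
    linarith

/-- A unit increase of the first coordinate from a point of small slope increases the `ℓ^p` norm
almost by one. -/
lemma one_sub_le_lp_increment {p a B δ : ℝ} (hp : 1 < p) (ha : 0 ≤ a) (hB : 0 ≤ B) (hδ : 0 ≤ δ)
    (h : B ≤ δ * a ^ p) :
    1 - δ ≤ ((a + 1) ^ p + B) ^ (1 / p) - (a ^ p + B) ^ (1 / p) := by
  have hp0 : 0 < p := by linarith
  -- By the mean value theorem the increment is `c ^ (p - 1) * (c ^ p + B) ^ (1 / p - 1)` for some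
  -- `c > a`. As `B ≤ δ * c ^ p`, this is at least `(1 + δ) ^ (1 / p - 1) ≥ (1 + δ)⁻¹ ≥ 1 - δ`.
  obtain ⟨c, ⟨hc, -⟩, hc'⟩ := exists_hasDerivAt_eq_slope
    (fun x : ℝ => (x ^ p + B) ^ (1 / p))
    (fun x => (p * x ^ (p - 1)) * (1 / p) * (x ^ p + B) ^ (1 / p - 1)) (lt_add_one a)
    (by
      apply ContinuousOn.rpow_const
      · exact ((Real.continuous_rpow_const hp0.le).add continuous_const).continuousOn
      · intro x _; right; positivity)
    (by
      intro x hx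
      have hx0 : 0 < x := ha.trans_lt hx.1
      refine HasDerivAt.rpow_const ((Real.hasDerivAt_rpow_const (Or.inl hx0.ne')).add_const B)
        (Or.inl ?_)
      positivity)
  simp only [add_sub_cancel_left, div_one] at hc'
  rw [← hc']
  have hc0 : 0 < c := ha.trans_lt hc
  have hcB : c ^ p + B ≤ c ^ p * (1 + δ) := by
    have : a ^ p ≤ c ^ p := by gcongr
    nlinarith
  have h1 : (c ^ p * (1 + δ)) ^ (1 / p - 1) ≤ (c ^ p + B) ^ (1 / p - 1) := by
    apply Real.rpow_le_rpow_of_nonpos (by positivity) hcB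
    have : 1 / p ≤ 1 := by rw [div_le_one hp0]; exact hp.le
    linarith
  have h2 : (c ^ p * (1 + δ)) ^ (1 / p - 1) = c ^ (1 - p) * (1 + δ) ^ (1 / p - 1) := by
    rw [Real.mul_rpow (by positivity) (by positivity), ← Real.rpow_mul hc0.le]
    congr 2
    field_simp
  have h3 : (1 - δ) ≤ (1 + δ) ^ (1 / p - 1) := by
    have : (1 + δ) ^ (-1 : ℝ) ≤ (1 + δ) ^ (1 / p - 1) := by
      apply Real.rpow_le_rpow_of_exponent_le (by linarith)
      have : 0 < 1 / p := by positivity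
      linarith
    refine le_trans ?_ this
    rw [Real.rpow_neg_one, ← one_div, le_div_iff₀ (by positivity)]
    nlinarith
  have h4 : c ^ (p - 1) * c ^ (1 - p) = 1 := by
    rw [← Real.rpow_add hc0]; simp
  calc 1 - δ ≤ (1 + δ) ^ (1 / p - 1) := h3
    _ = c ^ (p - 1) * (c ^ p * (1 + δ)) ^ (1 / p - 1) := by rw [h2, ← mul_assoc, h4, one_mul]
    _ ≤ c ^ (p - 1) * (c ^ p + B) ^ (1 / p - 1) := by gcongr
    _ = _ := by field_simp

open Filter Topology in
/-- In a cone of slope `1 / N` about the first axis, horizontal steps increase the `ℓ^q` norm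
by `1 - o(1 / N)`. -/
lemma eventually_one_sub_le_lqDist_increment {q : ℝ≥0∞} (hq : 1 < q) {κ : ℝ} (hκ : 0 < κ) :
    ∀ᶠ N : ℕ in atTop, ∃ δ : ℝ, 0 ≤ δ ∧ N * δ ≤ κ ∧ ∀ a b : ℤ, 0 ≤ a → 0 ≤ b → N * b ≤ a →
      1 - δ ≤ lqDist q 0 (site (a + 1) b) - lqDist q 0 (site a b) := by
  by_cases hq' : q = ∞
  · subst hq'
    filter_upwards [eventually_ge_atTop 1] with N hN
    refine ⟨0, le_rfl, by simpa using hκ.le, fun a b ha hb hab => ?_⟩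
    have hba : b ≤ a := by nlinarith
    have hba' : (b : ℝ) ≤ a := by exact_mod_cast hba
    rw [lqDist_top_zero_site ha hb, lqDist_top_zero_site (by omega) hb, max_eq_left hba',
      max_eq_left (by push_cast; linarith)]
    push_cast; linarith
  · set p := q.toReal with hp
    have hp1 : 1 < p := by
      rw [hp, ← ENNReal.toReal_one]
      exact (ENNReal.toReal_lt_toReal ENNReal.one_ne_top hq').2 hq
    have hlim : Tendsto (fun N : ℕ => (N : ℝ) ^ (-(p - 1))) atTop (𝓝 0) :=
      (tendsto_rpow_neg_atTop (by linarith)).comp tendsto_natCast_atTop_atTop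
    filter_upwards [eventually_ge_atTop 1, hlim.eventually (ge_mem_nhds hκ)] with N hN hNκ
    have hN0 : (0 : ℝ) < N := by exact_mod_cast hN
    -- The cone condition gives `b ^ p ≤ N ^ (-p) * a ^ p`, and `N * N ^ (-p)` tends to `0` exactly
    -- because `p > 1`.
    refine ⟨(N : ℝ) ^ (-p), by positivity, ?_, fun a b ha hb hab => ?_⟩
    · calc (N : ℝ) * (N : ℝ) ^ (-p) = (N : ℝ) ^ (-(p - 1)) := by
            rw [← Real.rpow_one_add' hN0.le (by linarith)]; congr 1; ring
        _ ≤ κ := hNκ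
    · have ha' : (0 : ℝ) ≤ a := by exact_mod_cast ha
      have hb' : (0 : ℝ) ≤ b := by exact_mod_cast hb
      have hab' : (N : ℝ) * b ≤ a := by exact_mod_cast hab
      rw [lqDist_zero_site_of_ne_top hq hq' ha hb, lqDist_zero_site_of_ne_top hq hq' (by omega) hb]
      push_cast
      refine one_sub_le_lp_increment hp1 ha' (by positivity) (by positivity) ?_
      calc (b : ℝ) ^ p = (N : ℝ) ^ (-p) * ((N : ℝ) * b) ^ p := by
            rw [Real.mul_rpow hN0.le hb', ← mul_assoc, ← Real.rpow_add hN0]; simp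
        _ ≤ (N : ℝ) ^ (-p) * (a : ℝ) ^ p := by gcongr

end RMF

/-! ### Lipschitz paths and their dual paths -/

namespace RMF

/-- Dual reachability: the sites that lie on or below every Lipschitz path of open sites that
starts at height at least `0`. -/
inductive DualReach (closed : ℤ × ℤ → Prop) : ℤ × ℤ → Prop
  | origin : DualReach closed 0
  | up (z) : DualReach closed z → closed z → DualReach closed (z + (0, 1))
  | right (z) : DualReach closed z → DualReach closed (z + (1, 0))
  | left (z) : DualReach closed z → DualReach closed (z + (-1, -1))

/-- The three steps of dual paths. -/
def dualStep : Fin 3 → ℤ × ℤ := ![(0, 1), (1, 0), (-1, -1)]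

/-- The end of the dual path from the origin whose steps are the given ones, the last step
coming first. -/
def wordEnd : List (Fin 3) → ℤ × ℤ
  | [] => 0
  | s :: w => wordEnd w + dualStep s

/-- The sites visited by a dual path. -/
def wordVisited : List (Fin 3) → Finset (ℤ × ℤ)
  | [] => {0}
  | s :: w => insert (wordEnd (s :: w)) (wordVisited w)

/-- The sites from which a dual path steps up. -/
def wordUps : List (Fin 3) → Finset (ℤ × ℤ)
  | [] => ∅
  | s :: w => if s = 0 then insert (wordEnd w) (wordUps w) else wordUps w

/-- A dual path that does not visit a site twice. -/
def SimpleWord : List (Fin 3) → Prop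
  | [] => True
  | s :: w => SimpleWord w ∧ wordEnd (s :: w) ∉ wordVisited w

variable {closed : ℤ × ℤ → Prop}

lemma wordEnd_mem_wordVisited (w : List (Fin 3)) : wordEnd w ∈ wordVisited w := by
  cases w <;> simp [wordVisited, wordEnd]

/-- Sites left by a step up were visited before the end. Hence each step up of a simple path adds a
new element to `wordUps`, whose cardinality counts the steps up. -/
lemma wordEnd_notMem_wordUps (w : List (Fin 3)) (hw : SimpleWord w) :
    wordEnd w ∉ wordUps w ∧ wordUps w ⊆ wordVisited w := by
  induction w with
  | nil => simp [wordUps]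
  | cons s w ih =>
    obtain ⟨h1, h2⟩ := ih hw.1
    have hsub : wordUps (s :: w) ⊆ wordVisited w := by
      rw [wordUps]
      split_ifs
      · exact Finset.insert_subset (wordEnd_mem_wordVisited w) h2
      · exact h2
    exact ⟨fun h => hw.2 (hsub h), hsub.trans (Finset.subset_insert _ _)⟩

/-- Each of the three kinds of step adds `1` to the right-hand side: `3 - 2` for up, `1` for right,
`-1 + 2` for the diagonal step. -/
lemma length_eq_of_simpleWord (w : List (Fin 3)) (hw : SimpleWord w) :
    (w.length : ℤ) = 3 * (wordUps w).card + (wordEnd w).1 - 2 * (wordEnd w).2 := by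
  induction w with
  | nil => simp [wordUps, wordEnd]
  | cons s w ih =>
    have h := ih hw.1
    have h1 := (wordEnd_notMem_wordUps w hw.1).1
    fin_cases s <;>
      simp [wordUps, wordEnd, dualStep, Finset.card_insert_of_notMem h1, h] <;> ring

lemma exists_simpleWord_of_mem_wordVisited (w : List (Fin 3)) (hw : SimpleWord w)
    (hc : ∀ z ∈ wordUps w, closed z) {z : ℤ × ℤ} (hz : z ∈ wordVisited w) :
    ∃ w', SimpleWord w' ∧ (∀ z ∈ wordUps w', closed z) ∧ wordEnd w' = z := by
  induction w with
  | nil => exact ⟨[], trivial, hc, by simpa [wordVisited, wordEnd, eq_comm] using hz⟩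
  | cons s w ih =>
    rcases Finset.mem_insert.1 hz with rfl | hz
    · exact ⟨s :: w, hw, hc, rfl⟩
    · refine ih hw.1 (fun x hx => hc x ?_) hz
      rw [wordUps]
      split_ifs
      · exact Finset.mem_insert_of_mem hx
      · exact hx

/-- Loop erasure: when a step returns to a visited site, the path is cut back to its earlier visit
there. -/
lemma DualReach.exists_simpleWord {z : ℤ × ℤ} (h : DualReach closed z) :
    ∃ w, SimpleWord w ∧ (∀ z ∈ wordUps w, closed z) ∧ wordEnd w = z := by
  have key : ∀ (s : Fin 3) (w : List (Fin 3)), SimpleWord w → (∀ z ∈ wordUps w, closed z) →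
      (s = 0 → closed (wordEnd w)) →
      ∃ w', SimpleWord w' ∧ (∀ z ∈ wordUps w', closed z) ∧ wordEnd w' = wordEnd w + dualStep s := by
    intro s w hw hc hs
    by_cases hmem : wordEnd w + dualStep s ∈ wordVisited w
    · exact exists_simpleWord_of_mem_wordVisited w hw hc hmem
    · refine ⟨s :: w, ⟨hw, hmem⟩, fun x hx => ?_, rfl⟩
      rw [wordUps] at hx
      split_ifs at hx with h0
      · rcases Finset.mem_insert.1 hx with rfl | hx
        · exact hs h0
        · exact hc x hx
      · exact hc x hx
  induction h with
  | origin => exact ⟨[], trivial, by simp [wordUps], rfl⟩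
  | up z _ hz ih =>
    obtain ⟨w, hw, hc, rfl⟩ := ih
    exact key 0 w hw hc fun _ => hz
  | right z _ ih =>
    obtain ⟨w, hw, hc, rfl⟩ := ih
    exact key 1 w hw hc (by simp)
  | left z _ ih =>
    obtain ⟨w, hw, hc, rfl⟩ := ih
    exact key 2 w hw hc (by simp)

/-- If no simple dual path through closed sites ends above the diagonal, then there is an
oriented Lipschitz path of open sites below the diagonal. -/
lemma exists_open_lipschitz_path
    (h : ∀ w, SimpleWord w → (∀ z ∈ wordUps w, closed z) → 0 ≤ (wordEnd w).1 →
      (wordEnd w).2 ≤ (wordEnd w).1) :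
    ∃ F : ℕ → ℤ, F 0 = 0 ∧ (∀ i, 0 ≤ F i) ∧ (∀ i, F i ≤ i) ∧ (∀ i : ℕ, ¬ closed (i, F i)) ∧
      ∀ i, F (i + 1) = F i ∨ F (i + 1) = F i + 1 := by
  have hbd : ∀ z, DualReach closed z → 0 ≤ z.1 → z.2 ≤ z.1 := by
    intro z hz h0
    obtain ⟨w, hw, hc, rfl⟩ := hz.exists_simpleWord
    exact h w hw hc h0
  have haxis : ∀ i : ℕ, DualReach closed ((i : ℤ), 0) := by
    intro i
    induction i with
    | zero => exact DualReach.origin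
    | succ i ih => simpa using ih.right
  -- The path is the top of the dual-reachable set in each column. Maximality against the steps up,
  -- right and diagonally left gives, in turn, open sites, no descent, and a rise of at most one.
  have hex : ∀ i : ℕ, ∃ m : ℤ, DualReach closed ((i : ℤ), m) ∧
      ∀ j : ℤ, DualReach closed ((i : ℤ), j) → j ≤ m := fun i =>
    Int.exists_greatest_of_bdd ⟨i, fun j hj => hbd _ hj (by simp)⟩ ⟨0, haxis i⟩
  choose F hF hmax using hex
  have hle : ∀ i, F i ≤ i := fun i => hbd _ (hF i) (by simp)
  have hpos : ∀ i, 0 ≤ F i := fun i => hmax i 0 (haxis i)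
  refine ⟨F, le_antisymm (by simpa using hle 0) (hpos 0), hpos, hle, fun i hi => ?_, fun i => ?_⟩
  · have := hmax i (F i + 1) (by simpa using (hF i).up _ hi)
    omega
  · have h1 : F i ≤ F (i + 1) := hmax (i + 1) _ (by simpa using (hF i).right)
    have h2 : F (i + 1) - 1 ≤ F i := hmax i _ (by simpa [sub_eq_add_neg] using (hF (i + 1)).left)
    omega

end RMF

/-! ### Probability that a block is closed -/

namespace RMF

/-- Disjoint blocks of an i.i.d. field are i.i.d. -/
lemma infinitePi_forall_mem {V ι κ : Type*} [Fintype ι] (P : Measure ℝ) [IsProbabilityMeasure P]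
    {f : ι × κ → V} (hf : Function.Injective f) {C : Set (κ → ℝ)} (hC : MeasurableSet C) :
    Measure.infinitePi (fun _ : V => P) {U | ∀ i, (fun k => U (f (i, k))) ∈ C} =
      Measure.infinitePi (fun _ : κ => P) C ^ Fintype.card ι := by
  have h1 := Measure.map_infinitePi_infinitePi_of_inj (P := fun _ : V => P) hf
  have h2 := Measure.infinitePi_map_curry (fun (_ : ι) (_ : κ) => P)
  rw [← h1, Measure.map_map (by fun_prop) (by fun_prop)] at h2
  have hm : MeasurableSet (Set.univ.pi (fun _ : ι => C)) :=
    MeasurableSet.univ_pi fun _ => hC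
  have h3 := congrArg (fun m => m (Set.univ.pi (fun _ : ι => C))) h2
  rw [Measure.map_apply (by fun_prop) hm, Measure.infinitePi_pi_univ _ (fun _ => hC),
    tprod_fintype, Finset.prod_const, Finset.card_univ] at h3
  rw [← h3]
  congr 1
  ext U
  simp [Set.mem_pi, MeasurableEquiv.curry]
  rfl

lemma uniform01_compl_Ioo_le (η : ℝ) :
    uniform01 (Set.Ioo η 1)ᶜ ≤ ENNReal.ofReal η := by
  rw [uniform01, Measure.restrict_apply measurableSet_Ioo.compl]
  calc volume ((Set.Ioo η 1)ᶜ ∩ Set.Ioo (0 : ℝ) 1) ≤ volume (Set.Ioc (0 : ℝ) η) := by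
        apply measure_mono
        rintro x ⟨hx, hx0, hx1⟩
        refine ⟨hx0, ?_⟩
        by_contra! h
        exact hx ⟨h, hx1⟩
    _ = ENNReal.ofReal η := by simp

lemma infinitePi_uniform01_exists_notMem_Ioo_le {V ι : Type*} [Fintype ι] (f : ι → V)
    (η : ℝ) :
    Measure.infinitePi (fun _ : V => uniform01) {U | ∃ i, U (f i) ∉ Set.Ioo η 1} ≤
      Fintype.card ι * ENNReal.ofReal η := by
  have hset : {U : V → ℝ | ∃ i, U (f i) ∉ Set.Ioo η 1} =
      ⋃ i, (fun U : V → ℝ => U (f i)) ⁻¹' (Set.Ioo η 1)ᶜ := by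
    ext; simp
  rw [hset]
  refine (measure_iUnion_fintype_le _ _).trans ?_
  calc _ ≤ ∑ _i : ι, ENNReal.ofReal η := by
        refine Finset.sum_le_sum fun i _ => ?_
        rw [(measurePreserving_eval_infinitePi (fun _ : V => uniform01) (f i)).measure_preimage
          measurableSet_Ioo.compl.nullMeasurableSet]
        exact uniform01_compl_Ioo_le η
    _ = _ := by simp

lemma uniform01_Iio_half : uniform01 (Set.Iio (1 / 2)) = 1 / 2 := by
  rw [uniform01, Measure.restrict_apply measurableSet_Iio]
  have : Set.Iio (1 / 2 : ℝ) ∩ Set.Ioo 0 1 = Set.Ioo 0 (1 / 2) := by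
    ext x; simp only [Set.mem_inter_iff, Set.mem_Iio, Set.mem_Ioo]
    constructor
    · rintro ⟨h1, h2, h3⟩; exact ⟨h2, h1⟩
    · rintro ⟨h1, h2⟩; exact ⟨h2, h1, by linarith⟩
  rw [this, Real.volume_Ioo, sub_zero, ENNReal.ofReal_div_of_pos two_pos]
  simp

lemma uniform01_Ici_half : uniform01 (Set.Ici (1 / 2)) = 1 / 2 := by
  rw [← Set.compl_Iio, prob_compl_eq_one_sub measurableSet_Iio, uniform01_Iio_half]
  simp

/-- The labels `u` at the columns of a block, in the row of the block (`false`) and the row above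
(`true`), prevent a passage to the right in either row or from the row to the one above. -/
def closedPattern (η : ℝ) (N : ℕ) : Set (Fin N × Bool → ℝ) :=
  {u | ∃ p, u p ∉ Set.Ioo η 1} ∪ {u | ∀ k, ¬ (u (k, false) < 1 / 2 ∧ 1 / 2 ≤ u (k, true))}

lemma measurableSet_closedPattern (η : ℝ) (N : ℕ) : MeasurableSet (closedPattern η N) := by
  refine MeasurableSet.union ?_ ?_
  · simp only [Set.ofPred_exists]
    exact MeasurableSet.iUnion fun p => (measurable_pi_apply p) measurableSet_Ioo.compl
  · simp only [Set.ofPred_forall]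
    refine MeasurableSet.iInter fun k => MeasurableSet.compl (MeasurableSet.inter ?_ ?_)
    · exact (measurable_pi_apply (k, false)) measurableSet_Iio
    · exact (measurable_pi_apply (k, true)) measurableSet_Ici

/-- The fixed threshold `1/2` makes the columns independent, each succeeding with probability `1/4`.
-/
lemma infinitePi_uniform01_no_rise (N : ℕ) :
    Measure.infinitePi (fun _ : Fin N × Bool => uniform01)
      {u | ∀ k, ¬ (u (k, false) < 1 / 2 ∧ 1 / 2 ≤ u (k, true))} = (3 / 4) ^ N := by
  set C : Set (Bool → ℝ) :=
    Set.univ.pi (fun r => if r then Set.Ici (1 / 2 : ℝ) else Set.Iio (1 / 2)) with hC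
  have hCm : MeasurableSet C := by
    refine MeasurableSet.univ_pi fun r => ?_
    cases r
    · exact measurableSet_Iio
    · exact measurableSet_Ici
  have h := infinitePi_forall_mem (ι := Fin N) (κ := Bool) uniform01 (f := id)
    Function.injective_id hCm.compl
  have hset : {U : Fin N × Bool → ℝ | ∀ i, (fun k => U (id (i, k))) ∈ Cᶜ} =
      {u | ∀ k, ¬ (u (k, false) < 1 / 2 ∧ 1 / 2 ≤ u (k, true))} := by
    ext u
    simp [hC]
  rw [hset] at h
  rw [h, prob_compl_eq_one_sub hCm, hC, Measure.infinitePi_pi_univ, tprod_fintype]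
  · simp only [Fintype.prod_bool, if_true, Bool.false_eq_true, if_false, uniform01_Iio_half,
      uniform01_Ici_half, Fintype.card_fin]
    congr 1
    rw [← ENNReal.toReal_eq_toReal_iff' (by simp) (by finiteness),
      ENNReal.toReal_sub_of_le _ (by simp)]
    · norm_num
    · rw [← ENNReal.toReal_le_toReal (by finiteness) (by simp)]
      norm_num
  · intro r
    cases r
    · exact measurableSet_Iio
    · exact measurableSet_Ici

lemma infinitePi_closedPattern_le {η : ℝ} (hη : 0 ≤ η) (N : ℕ) :
    Measure.infinitePi (fun _ : Fin N × Bool => uniform01) (closedPattern η N) ≤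
      ENNReal.ofReal (2 * N * η + (3 / 4) ^ N) := by
  refine (measure_union_le _ _).trans ?_
  rw [infinitePi_uniform01_no_rise, ENNReal.ofReal_add (by positivity) (by positivity)]
  gcongr
  · refine (infinitePi_uniform01_exists_notMem_Ioo_le (fun p : Fin N × Bool => p) η).trans ?_
    rw [ENNReal.ofReal_mul (by positivity)]
    gcongr
    rw [← ENNReal.ofReal_natCast]
    apply ENNReal.ofReal_le_ofReal
    simp [mul_comm]
  · rw [ENNReal.ofReal_pow (by norm_num), ENNReal.ofReal_div_of_pos (by norm_num)]
    simp

/-! ### Blocks in the lattice and the Peierls estimate -/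

/-- The sites of the block `z`: columns `N (z.1 + 1) + k` for `k < N`, in the rows `z.2` and
`z.2 + 1`. -/
def blockSite (N : ℕ) (z : ℤ × ℤ) (p : Fin N × Bool) : Fin 2 → ℤ :=
  site (N * (z.1 + 1) + (p.1 : ℕ)) (z.2 + if p.2 then 1 else 0)

/-- The block `z` is closed in the field `U`. -/
def ClosedBlock (η : ℝ) (N : ℕ) (U : (Fin 2 → ℤ) → ℝ) (z : ℤ × ℤ) : Prop :=
  (fun p => U (blockSite N z p)) ∈ closedPattern η N

lemma site_inj {a b c d : ℤ} : site a b = site c d ↔ a = c ∧ b = d := by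
  constructor
  · intro h
    exact ⟨congrFun h 0, congrFun h 1⟩
  · rintro ⟨rfl, rfl⟩; rfl

/-- Blocks occupy two rows, so they overlap only when their rows are adjacent. Those of one row
parity are disjoint, hence independent. -/
lemma blockSite_injOn_parity {N : ℕ} {z z' : ℤ × ℤ} {p p' : Fin N × Bool}
    (hz : z.2 % 2 = z'.2 % 2) (h : blockSite N z p = blockSite N z' p') : z = z' ∧ p = p' := by
  obtain ⟨h1, h2⟩ := site_inj.1 h
  obtain ⟨z1, z2⟩ := z
  obtain ⟨w1, w2⟩ := z'
  obtain ⟨⟨k, hk⟩, r⟩ := p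
  obtain ⟨⟨l, hl⟩, s⟩ := p'
  simp only at h1 h2 hz
  have hzw : z1 = w1 := by
    rcases lt_trichotomy z1 w1 with hlt | heq | hlt
    · have : (N : ℤ) * (z1 + 1) + N ≤ N * (w1 + 1) := by nlinarith
      omega
    · exact heq
    · have : (N : ℤ) * (w1 + 1) + N ≤ N * (z1 + 1) := by nlinarith
      omega
  subst hzw
  have hkl : k = l := by omega
  subst hkl
  cases r <;> cases s <;> simp at h2 ⊢ <;> omega

lemma uniformField_forall_closedBlock_le_of_parity {η : ℝ} (N : ℕ) (Z : Finset (ℤ × ℤ)) (c : ℤ)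
    (hZ : ∀ z ∈ Z, z.2 % 2 = c) :
    uniformField 2 {U | ∀ z ∈ Z, ClosedBlock η N U z} ≤
      Measure.infinitePi (fun _ : Fin N × Bool => uniform01) (closedPattern η N) ^ Z.card := by
  have hinj : Function.Injective
      (fun x : Z × (Fin N × Bool) => blockSite N (x.1 : ℤ × ℤ) x.2) := by
    rintro ⟨⟨z, hz⟩, p⟩ ⟨⟨z', hz'⟩, p'⟩ h
    obtain ⟨rfl, rfl⟩ := blockSite_injOn_parity ((hZ z hz).trans (hZ z' hz').symm) h
    rfl
  have h := infinitePi_forall_mem uniform01 hinj (measurableSet_closedPattern η N)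
  rw [Fintype.card_coe] at h
  rw [← h, uniformField]
  apply measure_mono
  intro U (hU : ∀ z ∈ Z, ClosedBlock η N U z) z
  exact hU z.1 z.2

lemma uniformField_forall_closedBlock_le {η : ℝ} {N n : ℕ} (Z : Finset (ℤ × ℤ))
    (hn : n ≤ 3 * Z.card)
    (hq : Measure.infinitePi (fun _ : Fin N × Bool => uniform01) (closedPattern η N) ≤
      (1 / 12) ^ 6) :
    uniformField 2 {U | ∀ z ∈ Z, ClosedBlock η N U z} ≤ (1 / 12) ^ n := by
  -- The larger parity class has at least half of `Z`, hence at least `n / 6` independent blocks.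
  -- The sixth power in `hq` compensates for this.
  have key : ∀ c : ℤ, n ≤ 6 * (Z.filter fun z => z.2 % 2 = c).card →
      uniformField 2 {U | ∀ z ∈ Z, ClosedBlock η N U z} ≤ (1 / 12) ^ n := by
    intro c hc
    calc _ ≤ uniformField 2 {U | ∀ z ∈ Z.filter fun z => z.2 % 2 = c, ClosedBlock η N U z} :=
          measure_mono fun U (hU : ∀ z ∈ Z, ClosedBlock η N U z) z hz => hU z (Finset.mem_filter.1 hz).1
      _ ≤ _ := uniformField_forall_closedBlock_le_of_parity N _ c
          fun z hz => (Finset.mem_filter.1 hz).2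
      _ ≤ ((1 / 12) ^ 6) ^ (Z.filter fun z => z.2 % 2 = c).card := by gcongr
      _ = (1 / 12) ^ (6 * (Z.filter fun z => z.2 % 2 = c).card) := by rw [pow_mul]
      _ ≤ (1 / 12) ^ n := pow_le_pow_right_of_le_one' (by simp) hc
  have hcard : Z.card = (Z.filter fun z => z.2 % 2 = 0).card +
      (Z.filter fun z => z.2 % 2 = 1).card := by
    rw [← Finset.card_filter_add_card_filter_not (s := Z) (fun z => z.2 % 2 = 0)]
    congr 2
    ext z
    simp only [Finset.mem_filter]
    constructor <;> rintro ⟨h1, h2⟩ <;> exact ⟨h1, by omega⟩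
  rcases le_total (Z.filter fun z => z.2 % 2 = 0).card (Z.filter fun z => z.2 % 2 = 1).card
    with h | h
  · exact key 1 (by omega)
  · exact key 0 (by omega)

/-- Some simple dual path through closed blocks ends above the diagonal. -/
def blockedEvent (η : ℝ) (N : ℕ) : Set ((Fin 2 → ℤ) → ℝ) :=
  {U | ∃ w, SimpleWord w ∧ (∀ z ∈ wordUps w, ClosedBlock η N U z) ∧ 0 ≤ (wordEnd w).1 ∧
    (wordEnd w).1 < (wordEnd w).2}

lemma uniformField_blockedEvent_le {η : ℝ} {N : ℕ}
    (hq : Measure.infinitePi (fun _ : Fin N × Bool => uniform01) (closedPattern η N) ≤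
      (1 / 12) ^ 6) :
    uniformField 2 (blockedEvent η N) ≤ 1 / 3 := by
  set G : List (Fin 3) → Set ((Fin 2 → ℤ) → ℝ) := fun w =>
    {U | SimpleWord w ∧ (∀ z ∈ wordUps w, ClosedBlock η N U z) ∧ 0 ≤ (wordEnd w).1 ∧
      (wordEnd w).1 < (wordEnd w).2} with hG
  have hGle : ∀ w, uniformField 2 (G w) ≤ (1 / 12) ^ w.length := by
    intro w
    by_cases hw : SimpleWord w ∧ 0 ≤ (wordEnd w).1 ∧ (wordEnd w).1 < (wordEnd w).2
    -- With `0 ≤ x < y` at the end, `x - 2 * y` is negative, so at least a third of the steps are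
    -- up.
    · have hlen := length_eq_of_simpleWord w hw.1
      refine le_trans (measure_mono fun U hU => hU.2.1)
        (uniformField_forall_closedBlock_le (wordUps w) ?_ hq)
      omega
    · have : G w = ∅ := by
        ext U
        simp only [hG, Set.mem_ofPred_eq, Set.mem_empty_iff_false, iff_false]
        exact fun h => hw ⟨h.1, h.2.2⟩
      simp [this]
  -- The empty word ends on the diagonal, so lengths start at `1`. The `3 ^ n` words of length `n`
  -- then contribute at most `(1 / 4) ^ n`, with sum `1/3`.
  have hsub : blockedEvent η N ⊆ ⋃ n : ℕ, ⋃ w : List.Vector (Fin 3) (n + 1), G w.1 := by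
    rintro U ⟨w, hw⟩
    have hlen : w.length ≠ 0 := by
      intro h0
      rw [List.length_eq_zero_iff.1 h0] at hw
      simp [wordEnd] at hw
    obtain ⟨n, hn⟩ := Nat.exists_eq_succ_of_ne_zero hlen
    exact Set.mem_iUnion.2 ⟨n, Set.mem_iUnion.2 ⟨⟨w, hn⟩, hw⟩⟩
  calc uniformField 2 (blockedEvent η N)
      ≤ ∑' n : ℕ, uniformField 2 (⋃ w : List.Vector (Fin 3) (n + 1), G w.1) :=
        (measure_mono hsub).trans (measure_iUnion_le _)
    _ ≤ ∑' n : ℕ, (1 / 4 : ℝ≥0∞) ^ (n + 1) := by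
        refine ENNReal.tsum_le_tsum fun n => ?_
        refine (measure_iUnion_fintype_le _ _).trans ?_
        calc _ ≤ ∑ _w : List.Vector (Fin 3) (n + 1), (1 / 12 : ℝ≥0∞) ^ (n + 1) := by
              refine Finset.sum_le_sum fun w _ => ?_
              simpa [w.2] using hGle w.1
          _ = (3 * (1 / 12)) ^ (n + 1) := by
              rw [Finset.sum_const, Finset.card_univ, card_vector, nsmul_eq_mul, mul_pow]
              simp
          _ = _ := by
              congr 1
              rw [← ENNReal.toReal_eq_toReal_iff' (by finiteness) (by simp)]
              norm_num
    _ = 1 / 3 := by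
        rw [ENNReal.tsum_geometric_add_one]
        rw [← ENNReal.toReal_eq_toReal_iff' _ (by simp)]
        · rw [ENNReal.toReal_mul, ENNReal.toReal_inv, ENNReal.toReal_sub_of_le _ (by simp)]
          · norm_num
          · simp
        · have : (1 : ℝ≥0∞) - 1 / 4 ≠ 0 := by
            rw [Ne, tsub_eq_zero_iff_le, not_le]
            rw [← ENNReal.toReal_lt_toReal (by simp) (by simp)]
            norm_num
          finiteness

/-- Some site of the initial segment of the first axis has an exceptional label. -/
def segmentBadEvent (η : ℝ) (N : ℕ) : Set ((Fin 2 → ℤ) → ℝ) :=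
  {U | ∃ k : Fin (N + 1), U (site (k : ℕ) 0) ∉ Set.Ioo η 1}

lemma uniformField_blockedEvent_union_segmentBadEvent_lt_one {η : ℝ} {N : ℕ} (hη : 0 ≤ η)
    (hN : 1 ≤ N) (h1 : 2 * N * η ≤ (1 / 12) ^ 6 / 2) (h2 : (3 / 4 : ℝ) ^ N ≤ (1 / 12) ^ 6 / 2) :
    uniformField 2 (blockedEvent η N ∪ segmentBadEvent η N) < 1 := by
  have hq : Measure.infinitePi (fun _ : Fin N × Bool => uniform01) (closedPattern η N) ≤
      (1 / 12) ^ 6 := by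
    refine (infinitePi_closedPattern_le hη N).trans ?_
    calc ENNReal.ofReal (2 * N * η + (3 / 4) ^ N) ≤ ENNReal.ofReal ((1 / 12) ^ 6) :=
          ENNReal.ofReal_le_ofReal (by linarith)
      _ = _ := by
          rw [ENNReal.ofReal_pow (by norm_num), ENNReal.ofReal_div_of_pos (by norm_num)]
          simp
  have hseg : uniformField 2 (segmentBadEvent η N) ≤ ENNReal.ofReal (1 / 3) := by
    refine (infinitePi_uniform01_exists_notMem_Ioo_le
      (fun k : Fin (N + 1) => site (k : ℕ) 0) η).trans ?_
    rw [← ENNReal.ofReal_natCast, ← ENNReal.ofReal_mul (by positivity)]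
    apply ENNReal.ofReal_le_ofReal
    have hN' : (1 : ℝ) ≤ N := by exact_mod_cast hN
    rw [Fintype.card_fin]
    push_cast
    norm_num at h1
    nlinarith
  calc _ ≤ (1 / 3 : ℝ≥0∞) + ENNReal.ofReal (1 / 3) :=
        (measure_union_le _ _).trans (add_le_add (uniformField_blockedEvent_le hq) hseg)
    _ < 1 := by
        rw [← ENNReal.toReal_lt_toReal (by finiteness) (by simp),
          ENNReal.toReal_add (by simp) (by simp)]
        norm_num

end RMF

/-! ### From open blocks to an increasing path -/

namespace RMF

/-- Infinitely many finite chains are concatenated without indexing: the vertices from which some `p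
i` can be reached in at least one step always have a successor of the same kind, since a chain that
ends at `p i` continues to `p (i + 1)`. -/
lemma exists_seq_of_forall_transGen {α : Type*} {r : α → α → Prop} (p : ℕ → α)
    (h : ∀ i, Relation.TransGen r (p i) (p (i + 1))) :
    ∃ x : ℕ → α, x 0 = p 0 ∧ ∀ j, r (x j) (x (j + 1)) := by
  have hstep : ∀ v : {v // ∃ i, Relation.TransGen r v (p i)},
      ∃ w : {v // ∃ i, Relation.TransGen r v (p i)}, r v w := by
    rintro ⟨v, i, hv⟩
    obtain ⟨w, hvw, hw⟩ := Relation.TransGen.head'_iff.1 hv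
    exact ⟨⟨w, i + 1, Relation.TransGen.trans_right hw (h i)⟩, hvw⟩
  choose f hf using hstep
  refine ⟨fun j => (f^[j] ⟨p 0, 1, h 0⟩ : {v // ∃ i, Relation.TransGen r v (p i)}), rfl,
    fun j => ?_⟩
  simp only [Function.iterate_succ_apply']
  exact hf _

/-- A step to the right or up in the positive quadrant along which the labels increase. -/
def LabelStep (q : ℝ≥0∞) (θ : ℝ) (U : (Fin 2 → ℤ) → ℝ) (v w : Fin 2 → ℤ) : Prop :=
  (∃ a b : ℤ, 0 ≤ a ∧ 0 ≤ b ∧ v = site a b ∧ (w = site (a + 1) b ∨ w = site a (b + 1))) ∧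
    label q θ U v < label q θ U w

lemma mem_percolationEvent_of_labelStep {q : ℝ≥0∞} {θ : ℝ} {U : (Fin 2 → ℤ) → ℝ}
    {x : ℕ → Fin 2 → ℤ} (h0 : x 0 = site 0 0) (hx : ∀ j, LabelStep q θ U (x j) (x (j + 1))) :
    U ∈ percolationEvent 2 q θ := by
  have haway : ∀ j, graphDist 0 (x j) < graphDist 0 (x (j + 1)) := by
    intro j
    obtain ⟨⟨a, b, ha, hb, hv, hw | hw⟩, -⟩ := hx j <;> rw [hv, hw] <;>
      simp only [graphDist, site, Fin.sum_univ_two, Pi.zero_apply, zero_sub, abs_neg,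
        Matrix.cons_val_zero, Matrix.cons_val_one] <;>
      rw [abs_of_nonneg ha, abs_of_nonneg hb, abs_of_nonneg (by omega)] <;> omega
  refine ⟨x, ⟨?_, fun j => ?_, ?_, haway⟩, fun j => (hx j).2⟩
  · rw [h0]; ext i; fin_cases i <;> rfl
  · obtain ⟨⟨a, b, ha, hb, hv, hw | hw⟩, -⟩ := hx j <;> rw [hv, hw] <;>
      simp [Adj, graphDist, site, Fin.sum_univ_two]
  · exact Function.Injective.of_comp (f := graphDist 0) (strictMono_nat_of_lt_succ haway).injective

section Geometry

variable {q : ℝ≥0∞} {θ δ : ℝ} {U : (Fin 2 → ℤ) → ℝ} {N : ℕ}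

/-- The norm need not grow along a step up (for `q = ∞` it may stay constant), so the increase has
to come from `U`. -/
lemma labelStep_up (hq : 1 < q) (hθ : 0 ≤ θ) {a b : ℤ} (ha : 0 ≤ a) (hb : 0 ≤ b)
    (h : U (site a b) < U (site a (b + 1))) :
    LabelStep q θ U (site a b) (site a (b + 1)) := by
  refine ⟨⟨a, b, ha, hb, rfl, Or.inr rfl⟩, ?_⟩
  have := mul_le_mul_of_nonneg_left (lqDist_le_lqDist_up hq ha hb) hθ
  rw [label, label]
  linarith

lemma labelStep_right (hθ : 0 ≤ θ)
    (hgain : ∀ a b : ℤ, 0 ≤ a → 0 ≤ b → N * b ≤ a →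
      1 - δ ≤ lqDist q 0 (site (a + 1) b) - lqDist q 0 (site a b))
    {a b : ℤ} (ha : 0 ≤ a) (hb : 0 ≤ b) (hab : N * b ≤ a)
    (h : U (site a b) < 1) (h' : 1 - θ * (1 - δ) < U (site (a + 1) b)) :
    LabelStep q θ U (site a b) (site (a + 1) b) := by
  refine ⟨⟨a, b, ha, hb, rfl, Or.inl rfl⟩, ?_⟩
  have := mul_le_mul_of_nonneg_left (hgain a b ha hb hab) hθ
  rw [label, label]
  linarith

lemma reflTransGen_labelStep_right (hθ : 0 ≤ θ)
    (hgain : ∀ a b : ℤ, 0 ≤ a → 0 ≤ b → N * b ≤ a →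
      1 - δ ≤ lqDist q 0 (site (a + 1) b) - lqDist q 0 (site a b))
    {a b : ℤ} (ha : 0 ≤ a) (hb : 0 ≤ b) (hab : N * b ≤ a) (n : ℕ)
    (h : ∀ k : ℕ, k ≤ n → U (site (a + k) b) ∈ Set.Ioo (1 - θ * (1 - δ)) 1) :
    Relation.ReflTransGen (LabelStep q θ U) (site a b) (site (a + n) b) := by
  induction n with
  | zero => simpa using Relation.ReflTransGen.refl
  | succ n ih =>
    refine (ih fun k hk => h k (by omega)).tail ?_
    have h1 := (h n (by omega)).2
    have h2 := (h (n + 1) le_rfl).1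
    push_cast at h2 ⊢
    rw [← add_assoc] at h2 ⊢
    exact labelStep_right hθ hgain (by omega) hb (by omega) h1 h2

lemma mem_percolationEvent_of_notMem (hq : 1 < q) (hθ : 0 ≤ θ) (hN : 1 ≤ N)
    (hgain : ∀ a b : ℤ, 0 ≤ a → 0 ≤ b → N * b ≤ a →
      1 - δ ≤ lqDist q 0 (site (a + 1) b) - lqDist q 0 (site a b))
    (hU : U ∉ blockedEvent (1 - θ * (1 - δ)) N ∪ segmentBadEvent (1 - θ * (1 - δ)) N) :
    U ∈ percolationEvent 2 q θ := by
  set η := 1 - θ * (1 - δ) with hη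
  obtain ⟨hblock, hseg⟩ := not_or.1 hU
  replace hseg : ∀ k : Fin (N + 1), U (site (k : ℕ) 0) ∈ Set.Ioo η 1 := by
    intro k
    by_contra h
    exact hseg ⟨k, h⟩
  obtain ⟨F, hF0, hFnonneg, hFle, hFopen, hFstep⟩ :=
    exists_open_lipschitz_path (closed := ClosedBlock η N U) (by
      intro w hw hc h0
      by_contra! h
      exact hblock ⟨w, hw, hc, h0, h⟩)
  have hgood : ∀ (i k : ℕ) (r : Bool), k < N →
      U (site (N * (i + 1) + k) (F i + if r then 1 else 0)) ∈ Set.Ioo η 1 := by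
    intro i k r hk
    by_contra h
    exact hFopen i (Or.inl ⟨(⟨k, hk⟩, r), h⟩)
  have hgood0 : ∀ i k : ℕ, k < N → U (site (N * (i + 1) + k) (F i)) ∈ Set.Ioo η 1 :=
    fun i k hk => by simpa using hgood i k false hk
  have hnext : ∀ i : ℕ, U (site (N * (i + 1) + N) (F (i + 1))) ∈ Set.Ioo η 1 := by
    intro i
    have := hgood0 (i + 1) 0 (by omega)
    convert this using 3
    push_cast
    ring
  have hrise : ∀ i : ℕ, ∃ k : ℕ, k < N ∧ U (site (N * (i + 1) + k) (F i)) <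
      U (site (N * (i + 1) + k) (F i + 1)) := by
    intro i
    by_contra! h
    refine hFopen i (Or.inr fun k hk => ?_)
    have h1 := h k k.2
    simp only [blockSite, Bool.false_eq_true, if_false, if_true, add_zero] at hk
    linarith
  -- The waypoints are the origin and then the lower left corners of the open blocks `(i, F i)`.
  set p : ℕ → Fin 2 → ℤ := fun i => Nat.casesOn i (site 0 0) fun i => site (N * (i + 1)) (F i)
    with hp
  have hpath : ∀ i, Relation.ReflTransGen (LabelStep q θ U) (p i) (p (i + 1)) := by
    intro i
    cases i with
    | zero =>
      have := reflTransGen_labelStep_right hθ hgain (a := 0) (b := 0) le_rfl le_rfl (by simp) N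
        (fun k hk => by simpa using hseg ⟨k, by omega⟩)
      simpa [hp, hF0] using this
    | succ i =>
      have ha : (0 : ℤ) ≤ N * (i + 1) := by positivity
      -- Blocks start at column `N`, one block to the right of the origin. With `F i ≤ i` this puts
      -- both rows of the block in the cone.
      have hslope : (N : ℤ) * F i + N ≤ N * (i + 1) := by
        have := mul_le_mul_of_nonneg_left (hFle i) (Int.natCast_nonneg N)
        linarith
      have hend : p (i + 1 + 1) = site (N * (i + 1) + N) (F (i + 1)) := by
        simp only [hp]
        congr 1
      rw [hend]
      change Relation.ReflTransGen _ (site (N * (i + 1)) (F i)) _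
      rcases hFstep i with hi | hi
      · have hn := hnext i
        rw [hi] at hn ⊢
        refine reflTransGen_labelStep_right hθ hgain ha (hFnonneg i) (by omega) N fun k hk => ?_
        rcases hk.lt_or_eq with hk | rfl
        · exact hgood0 i k hk
        · exact hn
      · have hn := hnext i
        rw [hi] at hn ⊢
        -- The path follows the lower row to the rising column `k`, steps up there, and follows the
        -- upper row to the next block.
        obtain ⟨k, hkN, hk⟩ := hrise i
        have hup := labelStep_up (q := q) hq hθ (by omega) (hFnonneg i) hk
        refine ((reflTransGen_labelStep_right hθ hgain ha (hFnonneg i) (by omega) k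
          fun l hl => hgood0 i l (by omega)).tail hup).trans ?_
        have hF1 : 0 ≤ F i + 1 := by linarith [hFnonneg i]
        have hslope' : (N : ℤ) * (F i + 1) ≤ N * (i + 1) + k := by linarith [Int.natCast_nonneg k]
        have := reflTransGen_labelStep_right (U := U) hθ hgain (by omega) hF1 hslope' (N - k)
          fun l hl => by
            rcases (show k + l ≤ N by omega).lt_or_eq with hlt | heq
            · have := hgood i (k + l) true hlt
              simpa [add_assoc] using this
            · have : ((k : ℤ) + l) = N := by exact_mod_cast heq
              rw [add_assoc, this]
              exact hn
        convert this using 2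
        push_cast [hkN.le]
        ring
  have hne : ∀ i, p i ≠ p (i + 1) := by
    intro i h
    cases i with
    | zero =>
      have := (site_inj.1 h).1
      simp at this
      omega
    | succ i =>
      have := (site_inj.1 h).1
      push_cast at this
      have hN' : (1 : ℤ) ≤ N := by exact_mod_cast hN
      linarith
  obtain ⟨x, hx0, hx⟩ := exists_seq_of_forall_transGen p fun i =>
    (Relation.reflTransGen_iff_eq_or_transGen.1 (hpath i)).resolve_left (hne i).symm
  exact mem_percolationEvent_of_labelStep hx0 hx

end Geometry

/-! ### Choice of the parameters -/

open Filter in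
lemma exists_uniformField_percolationEvent_pos {q : ℝ≥0∞} (hq : 1 < q) :
    ∃ θ₀ ∈ Set.Ico (0 : ℝ) 1, ∀ θ ∈ Set.Ioo θ₀ 1,
      0 < uniformField 2 (percolationEvent 2 q θ) := by
  have hpow : ∀ᶠ N : ℕ in atTop, (3 / 4 : ℝ) ^ N ≤ (1 / 12) ^ 6 / 2 :=
    (tendsto_pow_atTop_nhds_zero_of_lt_one (by norm_num) (by norm_num)).eventually
      (ge_mem_nhds (by norm_num))
  -- Since `η = (1 - θ) + θ * δ`, bounding both `N * (1 - θ)` and `N * δ` by `(1 / 12) ^ 6 / 8`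
  -- gives `2 * N * η ≤ (1 / 12) ^ 6 / 2`.
  obtain ⟨N, ⟨δ, hδ0, hδ, hgain⟩, hN, hNpow⟩ :=
    ((eventually_one_sub_le_lqDist_increment hq
      (κ := (1 / 12) ^ 6 / 8) (by norm_num)).and ((eventually_ge_atTop 1).and hpow)).exists
  have hN' : (1 : ℝ) ≤ N := by exact_mod_cast hN
  have hN0 : (0 : ℝ) < N := by linarith
  have hκ : (1 / 12 : ℝ) ^ 6 / 8 / N ≤ 1 :=
    (div_le_self (by norm_num) hN').trans (by norm_num)
  refine ⟨1 - (1 / 12) ^ 6 / 8 / N, ⟨by linarith, by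
    have : (0 : ℝ) < (1 / 12) ^ 6 / 8 / N := by positivity
    linarith⟩, fun θ hθ => ?_⟩
  have hθ0 : 0 ≤ θ := by linarith [hθ.1]
  have hθN : N * (1 - θ) ≤ (1 / 12 : ℝ) ^ 6 / 8 := by
    have h : 1 - θ ≤ (1 / 12 : ℝ) ^ 6 / 8 / N := by linarith [hθ.1]
    rw [le_div_iff₀ hN0] at h
    linarith
  have hη0 : 0 ≤ 1 - θ * (1 - δ) := by nlinarith [hθ.2]
  have hηN : 2 * N * (1 - θ * (1 - δ)) ≤ (1 / 12) ^ 6 / 2 := by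
    have : θ * δ ≤ δ := mul_le_of_le_one_left hδ0 hθ.2.le
    nlinarith
  have hbad := uniformField_blockedEvent_union_segmentBadEvent_lt_one hη0 hN hηN hNpow
  rw [pos_iff_ne_zero]
  intro hzero
  have : IsProbabilityMeasure (uniformField 2) := by unfold uniformField; infer_instance
  -- Covering the whole space needs only subadditivity, so measurability of the percolation event
  -- plays no role.
  have huniv : (Set.univ : Set ((Fin 2 → ℤ) → ℝ)) ⊆ percolationEvent 2 q θ ∪
      (blockedEvent (1 - θ * (1 - δ)) N ∪ segmentBadEvent (1 - θ * (1 - δ)) N) := by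
    intro U _
    by_cases hU : U ∈ blockedEvent (1 - θ * (1 - δ)) N ∪ segmentBadEvent (1 - θ * (1 - δ)) N
    · exact Or.inr hU
    · exact Or.inl (mem_percolationEvent_of_notMem hq hθ0 hN hgain hU)
  have hle := (measure_mono huniv).trans (measure_union_le (μ := uniformField 2) _ _)
  rw [hzero, zero_add, measure_univ] at hle
  exact hle.not_gt hbad

end RMF

theorem proposition1p7 (q : ℝ≥0∞) (hq : 1 < q) :
    (∃ θ₀ ∈ Set.Ico (0 : ℝ) 1, ∀ θ ∈ Set.Ioo θ₀ 1,
      0 < RMF.uniformField 2 (RMF.percolationEvent 2 q θ)) ∧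
    RMF.thetaC 2 q < 1 := by
  obtain ⟨θ₀, hθ₀, h⟩ := RMF.exists_uniformField_percolationEvent_pos hq
  refine ⟨⟨θ₀, hθ₀, h⟩, ?_⟩
  obtain ⟨θ, hθ⟩ := exists_between hθ₀.2
  refine (csInf_le ⟨0, fun x hx => hx.1.1⟩ ?_).trans_lt hθ.2
  exact ⟨⟨hθ₀.1.trans hθ.1.le, hθ.2.le⟩, h θ hθ⟩
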